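/- Consider the synchronous message-passing model on an $n$-vertex graph $G=(V,E)$ whose vertices have distinct identity numbers from $\{1,\dots,n\}$. In every round each vertex exchanges messages with its neighbours. Messages may be arbitrarily large, local computation is unrestricted, every vertex knows $n$ (and the parameter $k$, respectively $\varepsilon$), and every vertex has private, independent, fair random bits. The running time is the number of rounds until all vertices have terminated. Let $\chi(G)$ denote the chromatic number of $G$. A $\rho$-approximate colouring of $G$ is a proper colouring of $V$ with at most $\rho\cdot\chi(G)$ colours. "With high probability" means with probability at least $1-1/n^{c}$, where $c>0$ is an arbitrary constant fixed in advance. 1. For every $c>0$ there are constants $C,T$ (depending only on $c$) such that for all integers $n\ge 2$ and $k\ge 1$ there is a randomized distributed algorithm that, on every $n$-vertex graph $G$ and for every assignment of identity numbers, runs for at most $T\cdot 3^k\cdot k^2$ rounds and computes, with high probability, a $\bigl(C\,n^{2/k}\log n\bigr)$-approximate colouring of $G$. 2. In particular, an $O(n^{\varepsilon})$-approximation can be obtained in constant time: for every $c>0$ there is a constant $T$ (depending only on $c$) such that for every $\varepsilon>0$ there is a constant $C$ (depending only on $c$ and $\varepsilon$) such that for every $n\ge 2$ there is a randomized distributed algorithm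 that, on every $n$-vertex graph $G$ and for every assignment of identity numbers, runs for at most $T\cdot 3^{\lceil 1/\varepsilon\rceil}/\varepsilon^{2}$ rounds and computes, with high probability, a $\bigl(C\,n^{\varepsilon}\bigr)$-approximate colouring of $G$. -/

import Mathlib

/-- A randomized algorithm in the synchronous message-passing model on networks with `n` vertices
(the algorithm may depend on `n`).  Local computation and message size are unrestricted: `State`
and `Msg` are arbitrary types and the transition maps are arbitrary functions.

At the start a vertex knows only its own identity number in `Fin n` and its own private string of
`bits` fair coin flips.  In each round it puts a message on each of its incident edges and then
updates its state from the messages that it receives.  Vertices do not know their neighbours at the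
start, so `send s j` is the message placed on the edge towards a neighbour with identity `j`, if
there is one, and `recv s m` is the new state, where `m i = some x` if a neighbour with identity `i`
sent `x`, and `m i = none` if no neighbour has identity `i`.  After `rounds` rounds all vertices
terminate and each one outputs a colour. -/
structure RandomizedLocalAlgorithm (n : ℕ) where
  State : Type
  Msg : Type
  bits : ℕ
  rounds : ℕ
  init : Fin n → (Fin bits → Bool) → State
  send : State → Fin n → Msg
  recv : State → (Fin n → Option Msg) → State
  output : State → ℕ

namespace RandomizedLocalAlgorithm

open Classical in
/-- The state of each vertex after `t` rounds, when the algorithm is executed on the graph `G` with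
identity numbers `ident` and with private coin flips `ω v` at each vertex `v`. -/
noncomputable def stateAfter {n : ℕ} (A : RandomizedLocalAlgorithm n) {V : Type*}
    (G : SimpleGraph V) (ident : V ≃ Fin n) (ω : V → Fin A.bits → Bool) : ℕ → V → A.State
  | 0 => fun v => A.init (ident v) (ω v)
  | t + 1 => fun v =>
      A.recv (stateAfter A G ident ω t v) fun i =>
        if G.Adj (ident.symm i) v then
          some (A.send (stateAfter A G ident ω t (ident.symm i)) (ident v))
        else none

/-- The colours output by the vertices at the end of the execution. -/
noncomputable def coloring {n : ℕ} (A : RandomizedLocalAlgorithm n) {V : Type*}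
    (G : SimpleGraph V) (ident : V ≃ Fin n) (ω : V → Fin A.bits → Bool) (v : V) : ℕ :=
  A.output (A.stateAfter G ident ω A.rounds v)

/-- The probability of an event over the private coin flips of the vertices of a finite network:
all coins, of all vertices, are fair and mutually independent. -/
noncomputable def prob {n : ℕ} (A : RandomizedLocalAlgorithm n) {V : Type*}
    (E : Set (V → Fin A.bits → Bool)) : ℝ :=
  (Nat.card E : ℝ) / (Nat.card (V → Fin A.bits → Bool) : ℝ)

end RandomizedLocalAlgorithm

/-- `f` is a proper colouring of the (finite) graph `G` with colours `0, …, M - 1`, for some number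
of colours `M` that is at most `r` times the chromatic number of `G`. -/
def IsApproxColoring {V : Type*} (G : SimpleGraph V) (r : ℝ) (f : V → ℕ) : Prop :=
  (∀ u v : V, G.Adj u v → f u ≠ f v) ∧
    ∃ M : ℕ, (∀ v : V, f v < M) ∧ (M : ℝ) ≤ r * (G.chromaticNumber.toNat : ℝ)

/-! The colouring comes from a network decomposition in the style of Linial and Saks. Every vertex
`u` draws a truncated geometric radius `r ≤ k`, the initial run of successes among `k` trials with
success probability `1 / |B|`. A vertex joins the largest `u` whose ball of radius `r + 1` reaches
it, and is padded if that `u` is within distance `r`. Adjacent padded vertices have the same center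
(`center_eq_of_adj`).

If `|B| ^ k ≥ 2 * n`, a vertex is padded with probability at least `1 / (2 * |B|)`
(`card_incomplete_le`, `card_not_isPadded_le`). With `|B|` of order `n ^ (1 / k)`, about `|B| * log
n` independent partitions pad every vertex at least once, with high probability. Each vertex then
picks a partition in which it is padded, its level. Clusters on the same level are not joined by an
edge and have weak diameter at most `2 * k + 2`. Each is coloured optimally with the palette of its
level, which costs at most χ(G) colours per level.

Everything is determined by the view of radius `3 * k + 3` (`isLocal_decompositionColoring`), and a
full-information algorithm evaluates any local function (`ofLocal_coloring`). The resulting O(`n ^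
(1 / k) * log n`) approximation in `3 * k + 3` rounds is stronger than the first assertion; `k = ⌈2
/ ε⌉₊` gives the second. -/

/-! ### Local views and indistinguishability -/

/-- An input of the distributed system: a graph on the identity numbers together with the coin
flips of all vertices. -/
abbrev NetworkInput (n b : ℕ) : Type := SimpleGraph (Fin n) × (Fin n → Fin b → Bool)

namespace NetworkInput

variable {n b : ℕ}

/-- Two inputs are indistinguishable at `v` after `t` rounds of communication. -/
def Agree : ℕ → Fin n → NetworkInput n b → NetworkInput n b → Prop
  | 0, v, W, W' => W.2 v = W'.2 v
  | t + 1, v, W, W' => Agree t v W W' ∧ (∀ w, W.1.Adj w v ↔ W'.1.Adj w v) ∧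
      ∀ w, W.1.Adj w v → Agree t w W W'

theorem Agree.refl (W : NetworkInput n b) (t : ℕ) (v : Fin n) : Agree t v W W := by
  induction t generalizing v with
  | zero => rfl
  | succ t ih => exact ⟨ih v, fun _ => Iff.rfl, fun w _ => ih w⟩

theorem Agree.symm {W W' : NetworkInput n b} {t : ℕ} {v : Fin n} (h : Agree t v W W') :
    Agree t v W' W := by
  induction t generalizing v with
  | zero => exact Eq.symm h
  | succ t ih => exact ⟨ih h.1, fun w => (h.2.1 w).symm, fun w hw => ih (h.2.2 w ((h.2.1 w).2 hw))⟩

theorem Agree.mono {W W' : NetworkInput n b} {s t : ℕ} {v : Fin n} (hst : s ≤ t)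
    (h : Agree t v W W') : Agree s v W W' := by
  induction t, hst using Nat.le_induction with
  | base => exact h
  | succ t _ ih => exact ih h.1

theorem Agree.coins_eq {W W' : NetworkInput n b} {t : ℕ} {v : Fin n}
    (h : Agree t v W W') : W.2 v = W'.2 v :=
  h.mono (Nat.zero_le t)

theorem Agree.adj_iff {W W' : NetworkInput n b} {t : ℕ} {v : Fin n}
    (h : Agree t v W W') (ht : 1 ≤ t) (w : Fin n) : W.1.Adj w v ↔ W'.1.Adj w v :=
  (h.mono ht).2.1 w

/-- Each edge of the walk uses up one round of agreement, and the edges traversed also exist in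
`W'`. -/
theorem Agree.of_walk {W W' : NetworkInput n b} {s : ℕ} {u v : Fin n} (p : W.1.Walk v u)
    (h : Agree (s + p.length) v W W') : Agree s u W W' ∧ W'.1.edist v u ≤ p.length := by
  induction p with
  | nil => exact ⟨h, by simp⟩
  | @cons v x u hvx p ih =>
    rw [SimpleGraph.Walk.length_cons] at h ⊢
    obtain ⟨-, hadj, hnb⟩ : Agree ((s + p.length) + 1) v W W' := h
    obtain ⟨h1, h2⟩ := ih (hnb x hvx.symm)
    refine ⟨h1, (W'.1.edist_triangle (v := x)).trans ?_⟩
    rw [SimpleGraph.edist_eq_one_iff_adj.2 ((hadj x).1 hvx.symm).symm, add_comm]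
    push_cast
    gcongr

theorem Agree.of_edist_le {W W' : NetworkInput n b} {s j : ℕ} {u v : Fin n}
    (h : Agree (s + j) v W W') (hj : W.1.edist v u ≤ j) :
    Agree s u W W' ∧ W'.1.edist v u ≤ W.1.edist v u := by
  obtain ⟨p, hp⟩ := SimpleGraph.exists_walk_of_edist_ne_top (ne_top_of_le_ne_top (by simp) hj)
  rw [← hp] at hj ⊢
  have hj' : p.length ≤ j := by exact_mod_cast hj
  exact Agree.of_walk p (h.mono (by omega))

/-- A function of the input and a vertex is `t`-local if it is determined by what the vertex can
learn in `t` rounds. -/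
def IsLocal (t : ℕ) {α : Type*} (F : NetworkInput n b → Fin n → α) : Prop :=
  ∀ W W' v, Agree t v W W' → F W v = F W' v

end NetworkInput

/-! ### The full-information algorithm -/

namespace RandomizedLocalAlgorithm

open NetworkInput

variable {n b : ℕ}

open Classical in
/-- The full-information algorithm: each vertex maintains the set of all inputs that are consistent
with what it has learnt, and finally evaluates `F` on one of them. -/
noncomputable def ofLocal (t : ℕ) (F : NetworkInput n b → Fin n → ℕ) :
    RandomizedLocalAlgorithm n where
  State := Fin n × Set (NetworkInput n b)
  Msg := Set (NetworkInput n b)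
  bits := b
  rounds := t
  init v x := (v, {W | x = W.2 v})
  send s _ := s.2
  recv s m := (s.1, {W | W ∈ s.2 ∧ (∀ w, (m w).isSome ↔ W.1.Adj w s.1) ∧
    ∀ w K, m w = some K → W ∈ K})
  output s := if h : s.2.Nonempty then F h.some s.1 else 0

/-- The execution of an algorithm on `G`, seen as an input on the identity numbers. -/
def inputOf {V : Type*} (G : SimpleGraph V) (ident : V ≃ Fin n) (ω : V → Fin b → Bool) :
    NetworkInput n b :=
  (G.comap ident.symm, fun i => ω (ident.symm i))

theorem ofLocal_stateAfter (T : ℕ) (F : NetworkInput n b → Fin n → ℕ) {V : Type*}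
    (G : SimpleGraph V) (ident : V ≃ Fin n) (ω : V → Fin b → Bool) (t : ℕ) (v : V) :
    (ofLocal T F).stateAfter G ident ω t v =
      (ident v, {W | Agree t (ident v) (inputOf G ident ω) W}) := by
  classical
  induction t generalizing v with
  | zero =>
    simp [stateAfter, ofLocal, Agree, inputOf]
  | succ t ih =>
    change (ofLocal T F).recv ((ofLocal T F).stateAfter G ident ω t v) (fun i =>
      if G.Adj (ident.symm i) v then
        some ((ofLocal T F).send ((ofLocal T F).stateAfter G ident ω t (ident.symm i)) (ident v))
      else none) = _
    simp only [ih]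
    refine Prod.ext rfl (Set.ext fun W => ?_)
    simp only [ofLocal, Agree, Set.mem_ofPred_eq, inputOf, SimpleGraph.comap_adj,
      Equiv.symm_apply_apply, Equiv.apply_symm_apply]
    refine and_congr_right fun _ => and_congr (forall_congr' fun w => ?_)
      (forall_congr' fun w => ?_)
    · split_ifs with h <;> simp [h]
    · split_ifs with h
      · simp only [h, Option.some.injEq, forall_eq', Set.mem_ofPred_eq, forall_const]
      · simp [h]

/-- The final state holds exactly the inputs indistinguishable from the true one, and a local `F`
takes the same value on all of them, so the arbitrary choice in `output` is harmless. -/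
theorem ofLocal_coloring {t : ℕ} {F : NetworkInput n b → Fin n → ℕ} (hF : IsLocal t F)
    {V : Type*} (G : SimpleGraph V) (ident : V ≃ Fin n) (ω : V → Fin b → Bool) (v : V) :
    (ofLocal t F).coloring G ident ω v = F (inputOf G ident ω) (ident v) := by
  have hne : ({W | Agree t (ident v) (inputOf G ident ω) W} : Set (NetworkInput n b)).Nonempty :=
    ⟨_, Agree.refl _ _ _⟩
  have h : (ofLocal t F).coloring G ident ω v = F hne.some (ident v) := by
    change (ofLocal t F).output ((ofLocal t F).stateAfter G ident ω t v) = _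
    rw [ofLocal_stateAfter]
    exact dif_pos hne
  rw [h]
  exact (hF _ _ _ hne.some_mem).symm

end RandomizedLocalAlgorithm

/-! ### Truncated geometric radii and the padding probability -/

/-- The number of leading entries of `x` that are equal to `b₀`. -/
noncomputable def leadingRun {B : Type*} {k : ℕ} (b₀ : B) (x : Fin k → B) : ℕ :=
  sSup {j | j ≤ k ∧ ∀ i : Fin k, (i : ℕ) < j → x i = b₀}

section LeadingRun

variable {B : Type*} {k : ℕ} {b₀ : B}

theorem leadingRun_spec (b₀ : B) (x : Fin k → B) :
    leadingRun b₀ x ≤ k ∧ ∀ i : Fin k, (i : ℕ) < leadingRun b₀ x → x i = b₀ :=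
  Nat.sSup_mem (s := {j | j ≤ k ∧ ∀ i : Fin k, (i : ℕ) < j → x i = b₀})
    ⟨0, Nat.zero_le k, fun _ hi => absurd hi (Nat.not_lt_zero _)⟩ ⟨k, fun _ hj => hj.1⟩

theorem leadingRun_le (x : Fin k → B) : leadingRun b₀ x ≤ k :=
  (leadingRun_spec b₀ x).1

theorem le_leadingRun_iff {x : Fin k → B} {j : ℕ} (hj : j ≤ k) :
    j ≤ leadingRun b₀ x ↔ ∀ i : Fin k, (i : ℕ) < j → x i = b₀ :=
  ⟨fun h i hi => (leadingRun_spec b₀ x).2 i (hi.trans_le h),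
    fun h => le_csSup ⟨k, fun _ hj => hj.1⟩ ⟨hj, h⟩⟩

variable {V : Type*} [LinearOrder V]

/-- `u` is the largest vertex whose ball, with radius one more than its run, reaches a fixed
vertex, where `d u` is the distance of `u` from this vertex. -/
def IsCenter (b₀ : B) (d : V → ℕ∞) (ω : V → Fin k → B) (u : V) : Prop :=
  IsGreatest {u | d u ≤ leadingRun b₀ (ω u) + 1} u

/-- The vertex with distances `d` lies in the interior of the ball of its center. -/
def IsPadded (b₀ : B) (d : V → ℕ∞) (ω : V → Fin k → B) : Prop :=
  ∃ u, IsCenter b₀ d ω u ∧ d u ≤ leadingRun b₀ (ω u)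

theorem exists_isCenter [Finite V] (b₀ : B) {d : V → ℕ∞} {v : V} (hv : d v = 0)
    (ω : V → Fin k → B) : ∃ u, IsCenter b₀ d ω u := by
  have hne : {u | d u ≤ leadingRun b₀ (ω u) + 1}.Nonempty := ⟨v, by simp [hv]⟩
  obtain ⟨u, hu⟩ := (Set.toFinite {u | d u ≤ leadingRun b₀ (ω u) + 1}).exists_maximal hne
  exact ⟨u, hu.1, fun w hw => (le_total w u).elim id fun h => hu.2 hw h⟩

variable [Fintype V] [Finite B]

/-- Revealing the deciding trial last: among the outcomes where no run is complete, at least a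
fraction `1 / |B|` is padded. -/
theorem card_incomplete_le (b₀ : B) {d : V → ℕ∞} {v : V} (hv : d v = 0) :
    {ω : V → Fin k → B | ∀ u, leadingRun b₀ (ω u) < k}.ncard ≤
      {ω : V → Fin k → B | IsPadded b₀ d ω}.ncard * Nat.card B := by
  classical
  choose c hc using fun ω : V → Fin k → B => exists_isCenter b₀ hv ω
  -- If the center is at distance `m + 1`, its trial `m` decides padding. Turn that trial into a
  -- success and remember its old value, so that no information is lost.
  let φ : (V → Fin k → B) → (V → Fin k → B) × B := fun ω =>
    if h : ∃ m : Fin k, d (c ω) = (m : ℕ) + 1 then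
      (Function.update ω (c ω) (Function.update (ω (c ω)) h.choose b₀), ω (c ω) h.choose)
    else (ω, b₀)
  have hφ : ∀ ω, (∃ m : Fin k, d (c ω) = (m : ℕ) + 1 ∧
      φ ω = (Function.update ω (c ω) (Function.update (ω (c ω)) m b₀), ω (c ω) m)) ∨
      ((∀ m : Fin k, d (c ω) ≠ (m : ℕ) + 1) ∧ φ ω = (ω, b₀)) := by
    intro ω
    by_cases h : ∃ m : Fin k, d (c ω) = (m : ℕ) + 1
    · exact .inl ⟨h.choose, h.choose_spec, dif_pos h⟩
    · exact .inr ⟨fun m hm => h ⟨m, hm⟩, dif_neg h⟩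
  have hrun : ∀ (ω : V → Fin k → B) (m : Fin k), d (c ω) = (m : ℕ) + 1 →
      (m : ℕ) + 1 ≤ leadingRun b₀ (Function.update (ω (c ω)) m b₀) := by
    intro ω m hm
    have h1 : (m : ℕ) ≤ leadingRun b₀ (ω (c ω)) := by
      have := (hc ω).1
      rw [Set.mem_ofPred_eq, hm] at this
      exact Nat.le_of_succ_le_succ (by exact_mod_cast this)
    rw [le_leadingRun_iff m.2.le] at h1
    rw [le_leadingRun_iff m.2]
    intro i hi
    rcases eq_or_ne i m with rfl | him
    · simp
    · rw [Function.update_of_ne him]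
      exact h1 i (lt_of_le_of_ne (Nat.lt_succ_iff.1 hi) (fun h => him (Fin.ext h)))
  have hcen : ∀ ω, IsCenter b₀ d (φ ω).1 (c ω) := by
    intro ω
    rcases hφ ω with ⟨m, hm, h⟩ | ⟨-, h⟩
    -- Only the run of the center changes, and the center reaches the fixed vertex both before and
    -- after; hence the center can be read off from the image.
    · have : {u | d u ≤ leadingRun b₀ ((φ ω).1 u) + 1} =
          {u | d u ≤ leadingRun b₀ (ω u) + 1} := by
        ext u
        rcases eq_or_ne u (c ω) with rfl | hu
        · refine iff_of_true ?_ (hc ω).1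
          have h2 := hrun ω m hm
          simp only [h, Function.update_self, Set.mem_ofPred_eq]
          rw [hm]
          exact_mod_cast h2.trans (Nat.le_succ _)
        · simp [h, Function.update_of_ne hu]
      rw [IsCenter, this]
      exact hc ω
    · rw [h]
      exact hc ω
  rw [← Set.ncard_univ B, ← Set.ncard_prod]
  refine Set.ncard_le_ncard_of_injOn φ (fun ω hω => ⟨⟨c ω, hcen ω, ?_⟩, Set.mem_univ _⟩) ?_
    (Set.toFinite _)
  · rcases hφ ω with ⟨m, hm, h⟩ | ⟨hm, h⟩
    · rw [h, hm]
      simp only [Function.update_self]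
      exact_mod_cast hrun ω m hm
    · rw [h]
      have h1 : d (c ω) ≤ leadingRun b₀ (ω (c ω)) + 1 := (hc ω).1
      have h2 : leadingRun b₀ (ω (c ω)) < k := hω (c ω)
      obtain ⟨j, hj⟩ := ENat.ne_top_iff_exists.1 (ne_top_of_le_ne_top (by simp) h1)
      rw [← hj] at h1 hm ⊢
      -- An incomplete run gives distance at most `k`, so a positive distance is always `m + 1` for
      -- some `m < k`; only distance zero is left, which is padded.
      rcases j with _ | j
      · simp
      · have h3 : j + 1 ≤ leadingRun b₀ (ω (c ω)) + 1 := by exact_mod_cast h1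
        exact absurd (by push_cast; rfl) (hm ⟨j, by omega⟩)
  · intro ω _ ω' _ heq
    have hcc : c ω = c ω' := (hcen ω).unique (by rw [heq]; exact hcen ω')
    rcases hφ ω with ⟨m, hm, h⟩ | ⟨hm, h⟩ <;> rcases hφ ω' with ⟨m', hm', h'⟩ | ⟨hm', h'⟩
    · have hmm : m = m' := by
        rw [hcc, hm'] at hm
        have : (m' : ℕ) + 1 = m + 1 := by exact_mod_cast hm
        exact Fin.ext (by omega)
      subst hmm
      rw [h, h', ← hcc, Prod.mk.injEq] at heq
      ext u i
      rcases eq_or_ne u (c ω) with rfl | hu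
      · rcases eq_or_ne i m with rfl | hi
        · exact heq.2
        · have := congrFun (congrFun heq.1 (c ω)) i
          simpa [Function.update_of_ne hi] using this
      · have := congrFun (congrFun heq.1 u) i
        simpa [Function.update_of_ne hu] using this
    · exact absurd (hcc ▸ hm) (hm' m)
    · exact absurd (hcc ▸ hm') (hm m')
    · rw [h, h', Prod.mk.injEq] at heq
      exact heq.1

/-- A complete run fixes all trials of `u`, so they can be overwritten by arbitrary ones without
losing information. -/
theorem card_complete_le (b₀ : B) (u : V) :
    {ω : V → Fin k → B | leadingRun b₀ (ω u) = k}.ncard * Nat.card B ^ k ≤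
      Nat.card (V → Fin k → B) := by
  classical
  have hk : Nat.card B ^ k = Nat.card (Fin k → B) := by simp [Nat.card_pi]
  rw [hk, ← Set.ncard_univ (Fin k → B), ← Set.ncard_prod, ← Set.ncard_univ (V → Fin k → B)]
  refine Set.ncard_le_ncard_of_injOn (fun p => Function.update p.1 u p.2)
    (fun _ _ => Set.mem_univ _) ?_ (Set.toFinite _)
  have hone : ∀ ω : V → Fin k → B, leadingRun b₀ (ω u) = k → ω u = fun _ => b₀ := fun ω h =>
    funext fun i => (le_leadingRun_iff le_rfl).1 h.ge i i.2
  rintro ⟨ω, x⟩ ⟨hω, -⟩ ⟨ω', x'⟩ ⟨hω', -⟩ heq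
  have heq : Function.update ω u x = Function.update ω' u x' := heq
  have hx : x = x' := by simpa using congrFun heq u
  refine Prod.ext (funext fun w => ?_) hx
  rcases eq_or_ne w u with rfl | hw
  · exact (hone ω hω).trans (hone ω' hω').symm
  · simpa [Function.update_of_ne hw] using congrFun heq w

/-- By a union bound and `hB`, some run is complete with probability at most one half; of the
remaining half, the injection above turns a share `1 / |B|` into padded outcomes. -/
theorem card_not_isPadded_le (b₀ : B) {d : V → ℕ∞} {v : V} (hv : d v = 0)
    (hB : 2 * Fintype.card V ≤ Nat.card B ^ k) :
    ({ω : V → Fin k → B | ¬ IsPadded b₀ d ω}.ncard : ℝ) ≤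
      (1 - 1 / (2 * Nat.card B)) * Nat.card (V → Fin k → B) := by
  classical
  have hBpos : 0 < Nat.card B := Nat.card_pos_iff.2 ⟨⟨b₀⟩, inferInstance⟩
  have hB0 : (0 : ℝ) < Nat.card B := by exact_mod_cast hBpos
  have hVpos : 0 < Fintype.card V := Fintype.card_pos_iff.2 ⟨v⟩
  set Ω : ℝ := ((Nat.card (V → Fin k → B) : ℕ) : ℝ) with hΩ
  have hcompl : ∀ p : (V → Fin k → B) → Prop,
      ({ω | p ω}.ncard : ℝ) + ({ω | ¬ p ω}.ncard : ℝ) = Ω := by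
    intro p
    rw [hΩ, ← Set.ncard_add_ncard_compl {ω | p ω}]
    push_cast
    rfl
  have hbad : (({ω : V → Fin k → B | ¬ ∀ u, leadingRun b₀ (ω u) < k}.ncard : ℕ) : ℝ) ≤ Ω / 2 := by
    have hsub : {ω : V → Fin k → B | ¬ ∀ u, leadingRun b₀ (ω u) < k} ⊆
        ⋃ u ∈ (Finset.univ : Finset V), {ω : V → Fin k → B | leadingRun b₀ (ω u) = k} := by
      intro ω hω
      simp only [Set.mem_ofPred_eq, not_forall, not_lt] at hω
      obtain ⟨u, hu⟩ := hω
      simp only [Finset.mem_univ, Set.iUnion_true, Set.mem_iUnion, Set.mem_ofPred_eq]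
      exact ⟨u, (leadingRun_le _).antisymm hu⟩
    have h1 := (Set.ncard_le_ncard hsub (Set.toFinite _)).trans
      (Finset.set_ncard_biUnion_le _ _)
    have h2 : (∑ u : V, {ω : V → Fin k → B | leadingRun b₀ (ω u) = k}.ncard) *
        Nat.card B ^ k ≤ Fintype.card V * Nat.card (V → Fin k → B) := by
      rw [Finset.sum_mul]
      refine (Finset.sum_le_sum fun u _ => card_complete_le b₀ u).trans ?_
      simp
    have h3 := (Nat.mul_le_mul h1 hB).trans h2
    have h4 : {ω : V → Fin k → B | ¬ ∀ u, leadingRun b₀ (ω u) < k}.ncard * 2 ≤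
        Nat.card (V → Fin k → B) := by
      refine Nat.le_of_mul_le_mul_left ?_ hVpos
      calc _ = _ := by ring
        _ ≤ _ := h3
    rw [hΩ, le_div_iff₀ two_pos]
    exact_mod_cast h4
  have hgood := card_incomplete_le (k := k) b₀ hv
  have hgood' : ({ω : V → Fin k → B | ∀ u, leadingRun b₀ (ω u) < k}.ncard : ℝ) ≤
      {ω : V → Fin k → B | IsPadded b₀ d ω}.ncard * Nat.card B := by exact_mod_cast hgood
  have e1 := hcompl fun ω => ∀ u, leadingRun b₀ (ω u) < k
  have e2 := hcompl fun ω => IsPadded b₀ d ω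
  have h5 : Ω / (2 * Nat.card B) ≤ ({ω : V → Fin k → B | IsPadded b₀ d ω}.ncard : ℝ) := by
    rw [div_le_iff₀ (by positivity)]
    linarith
  calc _ ≤ Ω - Ω / (2 * Nat.card B) := by linarith
    _ = _ := by ring

end LeadingRun

/-! ### The network decomposition and its colouring -/

theorem SimpleGraph.exists_optimal_coloring {V : Type*} [Finite V] (K : SimpleGraph V) :
    ∃ f : V → ℕ, (∀ u v, K.Adj u v → f u ≠ f v) ∧ ∀ v, f v < K.chromaticNumber.toNat := by
  obtain ⟨C, hC⟩ := (K.colorable_iff_exists_bdd_nat_coloring _).1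
    K.colorable_chromaticNumber_of_fintype
  exact ⟨C, fun u v h => C.valid h, hC⟩

/-- A fixed proper colouring with the least number of colours. -/
noncomputable def SimpleGraph.optimalColoring {V : Type*} [Finite V] (K : SimpleGraph V) : V → ℕ :=
  K.exists_optimal_coloring.choose

namespace NetworkInput

variable {n b q k : ℕ} {B : Type*} (dec : (Fin b → Bool) ≃ (Fin (q + 1) → Fin k → B)) (b₀ : B)

/-- The random trials of all vertices for the `i`-th partition. -/
def trials (W : NetworkInput n b) (i : Fin (q + 1)) : Fin n → Fin k → B :=
  fun u => dec (W.2 u) i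

/-- The cluster center of `v` in the `i`-th partition. -/
noncomputable def center (W : NetworkInput n b) (i : Fin (q + 1)) (v : Fin n) : Fin n :=
  @Classical.epsilon _ ⟨v⟩ (IsCenter b₀ (fun u => W.1.edist u v) (trials dec W i))

/-- A partition in which `v` is padded, if there is one. -/
noncomputable def level (W : NetworkInput n b) (v : Fin n) : Fin (q + 1) :=
  Classical.epsilon fun i => IsPadded b₀ (fun u => W.1.edist u v) (trials dec W i)

/-- The cluster of `v` in the network decomposition, given by its level and its center. -/
noncomputable def cluster (W : NetworkInput n b) (v : Fin n) : Fin (q + 1) × Fin n :=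
  (level dec b₀ W v, center dec b₀ W (level dec b₀ W v) v)

/-- The graph with the edges that lie inside the cluster of `v`. -/
def clusterGraph (W : NetworkInput n b) (v : Fin n) : SimpleGraph (Fin n) where
  Adj x y := W.1.Adj x y ∧ cluster dec b₀ W x = cluster dec b₀ W v ∧
    cluster dec b₀ W y = cluster dec b₀ W v
  symm := ⟨fun _ _ h => ⟨h.1.symm, h.2.2, h.2.1⟩⟩
  loopless := ⟨fun _ h => h.1.ne rfl⟩

/-- Each cluster is coloured optimally, with a palette that depends on its level. -/
noncomputable def decompositionColoring (W : NetworkInput n b) (v : Fin n) : ℕ :=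
  level dec b₀ W v + (q + 1) * (clusterGraph dec b₀ W v).optimalColoring v

variable {dec b₀}

theorem center_spec (W : NetworkInput n b) (i : Fin (q + 1)) (v : Fin n) :
    IsCenter b₀ (fun u => W.1.edist u v) (trials dec W i) (center dec b₀ W i v) :=
  Classical.epsilon_spec (p := IsCenter b₀ (fun u => W.1.edist u v) (trials dec W i))
    (exists_isCenter b₀ (d := fun u => W.1.edist u v) W.1.edist_self _)

theorem edist_center_le (W : NetworkInput n b) (i : Fin (q + 1)) (v : Fin n) :
    W.1.edist (center dec b₀ W i v) v ≤ (k + 1 : ℕ) := by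
  have h : W.1.edist (center dec b₀ W i v) v ≤ _ := (center_spec (dec := dec) (b₀ := b₀) W i v).1
  refine h.trans ?_
  push_cast
  gcongr
  exact leadingRun_le _

theorem edist_le_of_cluster_eq {W : NetworkInput n b} {v w : Fin n}
    (h : cluster dec b₀ W w = cluster dec b₀ W v) :
    W.1.edist v w ≤ (2 * k + 2 : ℕ) := by
  have h1 := edist_center_le (dec := dec) (b₀ := b₀) W (level dec b₀ W w) w
  have h2 := edist_center_le (dec := dec) (b₀ := b₀) W (level dec b₀ W v) v
  have h3 : center dec b₀ W (level dec b₀ W w) w = center dec b₀ W (level dec b₀ W v) v :=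
    congrArg Prod.snd h
  rw [h3] at h1
  rw [W.1.edist_comm] at h2
  calc _ ≤ _ := W.1.edist_triangle
    _ ≤ _ := add_le_add h2 h1
    _ = _ := by push_cast; ring

/-- Radii are at most `k`, so only vertices within distance `k + 1` matter. The case `e = 1` serves
for centers, `e = 0` for padding. -/
theorem Agree.edist_le_run {W W' : NetworkInput n b} {v : Fin n} (h : Agree (k + 1) v W W')
    (i : Fin (q + 1)) (u : Fin n) {e : ℕ} (he : e ≤ 1)
    (hu : W.1.edist u v ≤ leadingRun b₀ (trials dec W i u) + e) :
    W'.1.edist u v ≤ leadingRun b₀ (trials dec W' i u) + e := by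
  rw [SimpleGraph.edist_comm] at hu ⊢
  have hle : (leadingRun b₀ (trials dec W i u) + e : ℕ∞) ≤ (k + 1 : ℕ) := by
    exact_mod_cast add_le_add (leadingRun_le _) he
  obtain ⟨h1, h2⟩ := Agree.of_edist_le (s := 0) (by simpa using h) (hu.trans hle)
  have h3 : trials dec W i u = trials dec W' i u := by
    rw [trials, trials, h1.coins_eq]
  rw [← h3]
  exact h2.trans hu

theorem Agree.edist_le_run_iff {W W' : NetworkInput n b} {v : Fin n} (h : Agree (k + 1) v W W')
    (i : Fin (q + 1)) (u : Fin n) {e : ℕ} (he : e ≤ 1) :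
    W.1.edist u v ≤ leadingRun b₀ (trials dec W i u) + e ↔
      W'.1.edist u v ≤ leadingRun b₀ (trials dec W' i u) + e :=
  ⟨h.edist_le_run i u he, h.symm.edist_le_run i u he⟩

theorem Agree.cluster_eq {W W' : NetworkInput n b} {v : Fin n} (h : Agree (k + 1) v W W') :
    cluster dec b₀ W v = cluster dec b₀ W' v := by
  -- Equality of predicates is needed, because `Classical.epsilon` makes the same choice only for
  -- equal predicates.
  have h1 : ∀ i, IsCenter b₀ (fun u => W.1.edist u v) (trials dec W i) =
      IsCenter b₀ (fun u => W'.1.edist u v) (trials dec W' i) := by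
    intro i
    funext u
    simp only [IsCenter]
    congr 1
    ext u
    exact_mod_cast h.edist_le_run_iff i u le_rfl
  have h2 : level dec b₀ W v = level dec b₀ W' v := by
    simp only [level, IsPadded, h1]
    congr 1
    funext i
    refine propext (exists_congr fun u => and_congr_right fun _ => ?_)
    simpa using h.edist_le_run_iff i u (Nat.zero_le 1)
  simp only [cluster, h2, center, h1]

/-- Members of the cluster are within `2 * k + 2` of `v`, and each needs `k + 1` further rounds to
determine its own cluster. -/
theorem Agree.clusterGraph_le {W W' : NetworkInput n b} {v : Fin n}
    (h : Agree (3 * k + 3) v W W') : clusterGraph dec b₀ W v ≤ clusterGraph dec b₀ W' v := by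
  have key : ∀ x, cluster dec b₀ W x = cluster dec b₀ W v →
      Agree (k + 1) x W W' := fun x hx =>
    (Agree.of_edist_le (s := k + 1) (by convert h using 1; ring) (edist_le_of_cluster_eq hx)).1
  intro x y ⟨h1, h2, h3⟩
  have hv : Agree (k + 1) v W W' := h.mono (by omega)
  have hx := key x h2
  have hy := key y h3
  refine ⟨(hy.adj_iff (by omega) x).1 h1, ?_, ?_⟩
  · rw [← hx.cluster_eq, ← hv.cluster_eq, h2]
  · rw [← hy.cluster_eq, ← hv.cluster_eq, h3]

theorem isLocal_decompositionColoring :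
    IsLocal (3 * k + 3) (decompositionColoring (n := n) dec b₀) := by
  intro W W' v h
  have h1 : clusterGraph dec b₀ W v = clusterGraph dec b₀ W' v :=
    le_antisymm h.clusterGraph_le h.symm.clusterGraph_le
  have h2 : level dec b₀ W v = level dec b₀ W' v :=
    congrArg Prod.fst (Agree.cluster_eq (dec := dec) (b₀ := b₀) (h.mono (by omega)))
  rw [decompositionColoring, decompositionColoring, h1, h2]

/-- The cluster graph is a subgraph of the network. No padding is needed here: bad coins can spoil
only properness. -/
theorem decompositionColoring_lt (W : NetworkInput n b) (v : Fin n) :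
    decompositionColoring dec b₀ W v < (q + 1) * W.1.chromaticNumber.toNat := by
  have h1 := (clusterGraph dec b₀ W v).exists_optimal_coloring.choose_spec.2 v
  have h2 : (clusterGraph dec b₀ W v).chromaticNumber.toNat ≤ W.1.chromaticNumber.toNat := by
    refine ENat.toNat_le_toNat (SimpleGraph.chromaticNumber_mono _ fun x y h => h.1) ?_
    exact SimpleGraph.chromaticNumber_ne_top_iff_exists.2 ⟨_, W.1.colorable_of_fintype⟩
  have h3 := (level dec b₀ W v).2
  have h4 : (clusterGraph dec b₀ W v).optimalColoring v + 1 ≤ W.1.chromaticNumber.toNat :=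
    h1.trans_le h2
  calc _ < (q + 1) + (q + 1) * (clusterGraph dec b₀ W v).optimalColoring v :=
        Nat.add_lt_add_right h3 _
    _ = (q + 1) * ((clusterGraph dec b₀ W v).optimalColoring v + 1) := by ring
    _ ≤ _ := Nat.mul_le_mul_left _ h4

/-- If `v` is within the radius of its center, then its neighbour is within radius plus one, so this
center competes for the neighbour as well. By symmetry the two maxima coincide. -/
theorem center_eq_of_adj {W : NetworkInput n b} {i : Fin (q + 1)} {v w : Fin n}
    (hvw : W.1.Adj v w)
    (hv : IsPadded b₀ (fun u => W.1.edist u v) (trials dec W i))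
    (hw : IsPadded b₀ (fun u => W.1.edist u w) (trials dec W i)) :
    center dec b₀ W i v = center dec b₀ W i w := by
  have key : ∀ {v w : Fin n}, W.1.Adj v w →
      IsPadded b₀ (fun u => W.1.edist u v) (trials dec W i) →
      center dec b₀ W i v ≤ center dec b₀ W i w := by
    rintro v w hvw ⟨u, hu, hd⟩
    rw [(center_spec W i v).unique hu]
    refine (center_spec W i w).2 (W.1.edist_triangle.trans (add_le_add hd ?_))
    exact (SimpleGraph.edist_eq_one_iff_adj.2 hvw).le
  exact le_antisymm (key hvw hv) (key hvw.symm hw)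

theorem decompositionColoring_ne_of_adj {W : NetworkInput n b}
    (hW : ∀ v, ∃ i, IsPadded b₀ (fun u => W.1.edist u v) (trials dec W i))
    {v w : Fin n} (hvw : W.1.Adj v w) :
    decompositionColoring dec b₀ W v ≠ decompositionColoring dec b₀ W w := by
  have hpad : ∀ v, IsPadded b₀ (fun u => W.1.edist u v) (trials dec W (level dec b₀ W v)) :=
    fun v => Classical.epsilon_spec (hW v)
  intro heq
  have hl : level dec b₀ W v = level dec b₀ W w := by
    -- The residue of a colour modulo `q + 1` is the level.
    have := congrArg (· % (q + 1)) heq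
    simp only [decompositionColoring, Nat.add_mul_mod_self_left] at this
    rwa [Nat.mod_eq_of_lt (Fin.is_lt _), Nat.mod_eq_of_lt (Fin.is_lt _), Fin.val_inj] at this
  have hc : cluster dec b₀ W w = cluster dec b₀ W v := by
    rw [cluster, cluster, ← hl]
    exact Prod.ext rfl (center_eq_of_adj hvw (hpad v) (hl ▸ hpad w)).symm
  -- Members of a cluster see the same graph, hence use the same fixed optimal colouring without
  -- coordination.
  have hg : clusterGraph dec b₀ W w = clusterGraph dec b₀ W v := by
    ext x y
    simp only [clusterGraph, hc]
  rw [decompositionColoring, decompositionColoring, hl, hg, Nat.add_left_cancel_iff] at heq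
  have hadj : (clusterGraph dec b₀ W v).Adj v w := ⟨hvw, rfl, hc⟩
  exact (clusterGraph dec b₀ W v).exists_optimal_coloring.choose_spec.1 v w hadj
    (Nat.eq_of_mul_eq_mul_left (Nat.succ_pos q) heq)

end NetworkInput

/-! ### Success probability of the decomposition -/

namespace RandomizedLocalAlgorithm

open NetworkInput

theorem inputOf_chromaticNumber {n b : ℕ} {V : Type*} (G : SimpleGraph V) (ident : V ≃ Fin n)
    (ω : V → Fin b → Bool) : (inputOf G ident ω).1.chromaticNumber = G.chromaticNumber := by
  have e : G.comap ident.symm ≃g G := ⟨ident.symm, Iff.rfl⟩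
  exact le_antisymm (SimpleGraph.chromaticNumber_mono_of_hom e.toHom)
    (SimpleGraph.chromaticNumber_mono_of_hom e.symm.toHom)

section Probability

variable {n b q k : ℕ} {B : Type*} {dec : (Fin b → Bool) ≃ (Fin (q + 1) → Fin k → B)} {b₀ : B}
  {V : Type*}

theorem isApproxColoring_of_padded {G : SimpleGraph V} {ident : V ≃ Fin n}
    {ω : V → Fin b → Bool}
    (h : ∀ v, ∃ i, IsPadded b₀ (fun u => (inputOf G ident ω).1.edist u v)
      (trials dec (inputOf G ident ω) i)) :
    IsApproxColoring G ((q : ℝ) + 1)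
      ((ofLocal (3 * k + 3) (decompositionColoring dec b₀)).coloring G ident ω) := by
  have hcol := ofLocal_coloring (isLocal_decompositionColoring (dec := dec) (b₀ := b₀)) G ident ω
  refine ⟨fun u v huv => ?_, (q + 1) * G.chromaticNumber.toNat, fun v => ?_, ?_⟩
  · rw [hcol, hcol]
    exact decompositionColoring_ne_of_adj h (by simpa [inputOf] using huv)
  · rw [hcol, ← inputOf_chromaticNumber G ident ω]
    exact decompositionColoring_lt _ _
  · push_cast
    exact le_rfl

/-- Independence of the partitions in counting form: decoding embeds the bad outcomes into a product
of `q + 1` copies of the bad set `S` of a single partition. -/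
theorem card_never_padded_le [Finite B] (hB : 2 * n ≤ Nat.card B ^ k) (G : SimpleGraph V)
    (ident : V ≃ Fin n) (v : Fin n) :
    ({ω : V → Fin b → Bool | ∀ i, ¬ IsPadded b₀ (fun u => (inputOf G ident ω).1.edist u v)
      (trials dec (inputOf G ident ω) i)}.ncard : ℝ) ≤
      (1 - 1 / (2 * Nat.card B)) ^ (q + 1) * Nat.card (V → Fin b → Bool) := by
  set S : Set (Fin n → Fin k → B) :=
    {x | ¬ IsPadded b₀ (fun u => (G.comap ident.symm).edist u v) x} with hS
  have hB' : 2 * Fintype.card (Fin n) ≤ Nat.card B ^ k := by simpa using hB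
  have h1 : (S.ncard : ℝ) ≤ _ :=
    card_not_isPadded_le (k := k) b₀ (G.comap ident.symm).edist_self hB'
  have hcard : (Nat.card (V → Fin b → Bool) : ℝ) =
      (Nat.card (Fin n → Fin k → B) : ℝ) ^ (q + 1) := by
    have e : (V → Fin b → Bool) ≃ (Fin (q + 1) → Fin n → Fin k → B) :=
      (Equiv.arrowCongr ident dec).trans (Equiv.piComm _)
    rw [Nat.card_congr e, Nat.card_pi]
    simp
  have h2 : {ω : V → Fin b → Bool | ∀ i, ¬ IsPadded b₀
      (fun u => (inputOf G ident ω).1.edist u v) (trials dec (inputOf G ident ω) i)}.ncard ≤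
      (Set.univ.pi fun _ : Fin (q + 1) => S).ncard := by
    refine Set.ncard_le_ncard_of_injOn (fun ω i => trials dec (inputOf G ident ω) i)
      (fun ω hω i _ => hω i) (fun ω _ ω' _ heq => ?_) (Set.toFinite _)
    funext w
    refine dec.injective (funext fun i => ?_)
    have := congrFun (congrFun heq i) (ident w)
    simpa [trials, inputOf] using this
  have h3 : (Set.univ.pi fun _ : Fin (q + 1) => S).ncard = S.ncard ^ (q + 1) := by
    rw [← Nat.card_coe_set_eq, Nat.card_congr (Equiv.Set.univPi fun _ : Fin (q + 1) => S),
      Nat.card_pi]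
    simp
  rw [h3] at h2
  rw [hcard, ← mul_pow]
  calc _ ≤ ((S.ncard ^ (q + 1) : ℕ) : ℝ) := by exact_mod_cast h2
    _ = (S.ncard : ℝ) ^ (q + 1) := by push_cast; rfl
    _ ≤ _ := by gcongr

theorem one_sub_le_prob [Finite B] (hB : 2 * n ≤ Nat.card B ^ k) (G : SimpleGraph V)
    (ident : V ≃ Fin n) :
    1 - n * (1 - 1 / (2 * Nat.card B : ℝ)) ^ (q + 1) ≤
      (ofLocal (3 * k + 3) (decompositionColoring (n := n) dec b₀)).prob
        {ω | IsApproxColoring G ((q : ℝ) + 1)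
          ((ofLocal (3 * k + 3) (decompositionColoring dec b₀)).coloring G ident ω)} := by
  have : Finite V := Finite.of_equiv _ ident.symm
  set A := ofLocal (3 * k + 3) (decompositionColoring (n := n) dec b₀) with hA
  set E : Set (V → Fin b → Bool) :=
    {ω | IsApproxColoring G ((q : ℝ) + 1) (A.coloring G ident ω)} with hE
  have hΩ : 0 < (Nat.card (V → Fin b → Bool) : ℝ) := by exact_mod_cast Nat.card_pos
  change _ ≤ (Nat.card E : ℝ) / (Nat.card (V → Fin b → Bool) : ℝ)
  rw [le_div_iff₀ hΩ, Nat.card_coe_set_eq]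
  have h1 : (E.ncard : ℝ) + Eᶜ.ncard = Nat.card (V → Fin b → Bool) := by
    exact_mod_cast Set.ncard_add_ncard_compl E
  have h2 : Eᶜ ⊆ ⋃ v ∈ (Finset.univ : Finset (Fin n)), {ω : V → Fin b → Bool | ∀ i, ¬ IsPadded b₀
      (fun u => (inputOf G ident ω).1.edist u v) (trials dec (inputOf G ident ω) i)} := by
    intro ω hω
    by_contra hcon
    refine hω (isApproxColoring_of_padded fun v => ?_)
    by_contra hv
    exact hcon (Set.mem_biUnion (Finset.mem_coe.2 (Finset.mem_univ v)) (not_exists.1 hv))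
  have h3 := (Set.ncard_le_ncard h2 (Set.toFinite _)).trans (Finset.set_ncard_biUnion_le _ _)
  have h4 : (Eᶜ.ncard : ℝ) ≤
      n * ((1 - 1 / (2 * Nat.card B)) ^ (q + 1) * Nat.card (V → Fin b → Bool)) := by
    refine (Nat.cast_le.2 h3).trans ?_
    push_cast
    refine (Finset.sum_le_sum fun v _ => card_never_padded_le hB G ident v).trans ?_
    simp
  linarith

end Probability

theorem IsApproxColoring.mono {V : Type*} {G : SimpleGraph V} {r s : ℝ} {f : V → ℕ} (hrs : r ≤ s)
    (h : IsApproxColoring G r f) : IsApproxColoring G s f := by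
  obtain ⟨h1, M, h2, h3⟩ := h
  exact ⟨h1, M, h2, h3.trans (by gcongr)⟩

theorem prob_mono {n : ℕ} (A : RandomizedLocalAlgorithm n) {V : Type*} [Finite V]
    {E E' : Set (V → Fin A.bits → Bool)} (h : E ⊆ E') : A.prob E ≤ A.prob E' := by
  unfold prob
  gcongr
  exact Nat.card_mono (Set.toFinite _) h

/-! ### Choice of parameters -/

/-- Random blocks of `a` coins as the trials of `q + 1` partitions. -/
noncomputable def coinBlocks (q k a : ℕ) :
    (Fin ((q + 1) * k * a) → Bool) ≃ (Fin (q + 1) → Fin k → Fin a → Bool) :=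
  -- Any bijection will do, since it preserves the uniform distribution.
  Fintype.equivOfCardEq (by simp [← pow_mul]; ring)

/-- Colouring by a network decomposition that is obtained from `q + 1` partitions of Linial and Saks
with radii up to `k`, computed in parallel. -/
noncomputable def decompositionAlgorithm (n k a q : ℕ) : RandomizedLocalAlgorithm n :=
  ofLocal (3 * k + 3) (decompositionColoring (coinBlocks q k a) fun _ => true)

theorem decompositionAlgorithm_spec {n k a q : ℕ} (h : 2 * n ≤ 2 ^ (a * k)) {V : Type*}
    (G : SimpleGraph V) (ident : V ≃ Fin n) :
    1 - n * (1 - 1 / (2 * 2 ^ a : ℝ)) ^ (q + 1) ≤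
      (decompositionAlgorithm n k a q).prob {ω | IsApproxColoring G ((q : ℝ) + 1)
        ((decompositionAlgorithm n k a q).coloring G ident ω)} := by
  have hB : Nat.card (Fin a → Bool) = 2 ^ a := by simp
  have := one_sub_le_prob (dec := coinBlocks q k a) (b₀ := fun _ => true)
    (by rw [hB, ← pow_mul]; exact h) G ident
  rw [hB] at this
  exact_mod_cast this

/-- The number of coins per trial of the ball growing process. -/
def coinsPerTrial (n k : ℕ) : ℕ := Nat.clog 2 (2 * n) / k + 1

/-- One less than the number of partitions. -/
noncomputable def partitionCount (c : ℝ) (n k : ℕ) : ℕ :=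
  ⌈(c + 1) * (2 * 2 ^ coinsPerTrial n k) * Real.log n⌉₊

theorem two_mul_le_two_pow_coinsPerTrial (n : ℕ) {k : ℕ} (hk : 1 ≤ k) :
    2 * n ≤ 2 ^ (coinsPerTrial n k * k) := by
  refine (Nat.le_pow_clog one_lt_two (2 * n)).trans (Nat.pow_le_pow_right two_pos ?_)
  have := Nat.div_add_mod (Nat.clog 2 (2 * n)) k
  have := Nat.mod_lt (Nat.clog 2 (2 * n)) hk
  rw [coinsPerTrial]
  nlinarith

/-- Rounding up to a power of two gives at most `4 * n`, whose `k`-th root is at most `4 * n ^ (1 /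
k)`; the extra coin doubles this. -/
theorem two_pow_coinsPerTrial_le {n k : ℕ} (hn : 2 ≤ n) (hk : 1 ≤ k) :
    (2 : ℝ) ^ coinsPerTrial n k ≤ 8 * (n : ℝ) ^ ((1 : ℝ) / k) := by
  have hk0 : (0 : ℝ) < k := by exact_mod_cast hk
  have hlog : (2 : ℝ) ^ Nat.clog 2 (2 * n) ≤ 4 * n := by
    have h1 := Nat.pow_pred_clog_lt_self one_lt_two (x := 2 * n) (by omega)
    have h2 : Nat.clog 2 (2 * n) = (Nat.clog 2 (2 * n)).pred + 1 :=
      (Nat.succ_pred_eq_of_pos (Nat.clog_pos one_lt_two (by omega))).symm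
    rw [h2, pow_succ]
    have h3 : (2 : ℝ) ^ (Nat.clog 2 (2 * n)).pred ≤ 2 * n := by exact_mod_cast h1.le
    linarith
  have hdiv : ((Nat.clog 2 (2 * n) / k : ℕ) : ℝ) ≤ (Nat.clog 2 (2 * n) : ℝ) * (1 / k) := by
    rw [mul_one_div]
    exact Nat.cast_div_le
  have hk1 : (1 : ℝ) / k ≤ 1 := by
    rw [div_le_one hk0]
    exact_mod_cast hk
  have hpow : (2 : ℝ) ^ (Nat.clog 2 (2 * n) / k) ≤ 4 * (n : ℝ) ^ ((1 : ℝ) / k) := by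
    calc (2 : ℝ) ^ (Nat.clog 2 (2 * n) / k)
        = (2 : ℝ) ^ ((Nat.clog 2 (2 * n) / k : ℕ) : ℝ) := (Real.rpow_natCast _ _).symm
      _ ≤ (2 : ℝ) ^ ((Nat.clog 2 (2 * n) : ℝ) * (1 / k)) :=
        Real.rpow_le_rpow_of_exponent_le one_le_two hdiv
      _ = ((2 : ℝ) ^ Nat.clog 2 (2 * n)) ^ ((1 : ℝ) / k) := by
        rw [Real.rpow_mul two_pos.le, Real.rpow_natCast]
      _ ≤ (4 * n : ℝ) ^ ((1 : ℝ) / k) := by gcongr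
      _ = (4 : ℝ) ^ ((1 : ℝ) / k) * (n : ℝ) ^ ((1 : ℝ) / k) :=
        Real.mul_rpow (by norm_num) (Nat.cast_nonneg n)
      _ ≤ 4 * (n : ℝ) ^ ((1 : ℝ) / k) := by
        gcongr
        exact (Real.rpow_le_rpow_of_exponent_le (by norm_num) hk1).trans_eq (Real.rpow_one 4)
  rw [coinsPerTrial, pow_succ]
  linarith

/-- The exponent `c + 1` in place of `c` pays for the union bound over `n` vertices. -/
theorem one_sub_rpow_le {c : ℝ} {n k : ℕ} (hn : 2 ≤ n) :
    1 - 1 / (n : ℝ) ^ c ≤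
      1 - n * (1 - 1 / (2 * 2 ^ coinsPerTrial n k : ℝ)) ^ (partitionCount c n k + 1) := by
  have hn0 : (0 : ℝ) < n := by positivity
  set D : ℝ := 2 * 2 ^ coinsPerTrial n k with hD
  have hD1 : 1 ≤ D := by
    have : (1 : ℝ) ≤ 2 ^ coinsPerTrial n k := one_le_pow₀ one_le_two
    linarith
  have hD0 : 0 < D := one_pos.trans_le hD1
  have hq : (c + 1) * D * Real.log n ≤ (partitionCount c n k + 1 : ℕ) := by
    push_cast
    exact (Nat.le_ceil _).trans (by rw [partitionCount]; linarith)
  have h1 : (1 - 1 / D) ^ (partitionCount c n k + 1) ≤ (n : ℝ) ^ (-(c + 1)) := by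
    calc (1 - 1 / D) ^ (partitionCount c n k + 1)
        ≤ Real.exp (-(1 / D)) ^ (partitionCount c n k + 1) := by
          refine pow_le_pow_left₀ ?_ (Real.one_sub_le_exp_neg _) _
          rw [sub_nonneg, div_le_one hD0]
          exact hD1
      _ = Real.exp (-((partitionCount c n k + 1 : ℕ) / D)) := by
          rw [← Real.exp_nat_mul]
          congr 1
          ring
      _ ≤ Real.exp (Real.log n * -(c + 1)) := by
          refine Real.exp_le_exp.2 ?_
          have : (c + 1) * Real.log n ≤ (partitionCount c n k + 1 : ℕ) / D := by
            rw [le_div_iff₀ hD0]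
            linarith
          linarith
      _ = (n : ℝ) ^ (-(c + 1)) := (Real.rpow_def_of_pos hn0 _).symm
  have h2 : (n : ℝ) * (n : ℝ) ^ (-(c + 1)) = 1 / (n : ℝ) ^ c := by
    nth_rw 1 [← Real.rpow_one (n : ℝ)]
    rw [one_div, ← Real.rpow_neg hn0.le, ← Real.rpow_add hn0]
    congr 1
    ring
  have h3 := mul_le_mul_of_nonneg_left h1 hn0.le
  linarith

theorem half_lt_log {n : ℕ} (hn : 2 ≤ n) : 1 / 2 < Real.log n := by
  have h1 : Real.log 2 ≤ Real.log n := Real.log_le_log two_pos (by exact_mod_cast hn)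
  linarith [Real.log_two_gt_d9]

theorem partitionCount_add_one_le {c : ℝ} (hc : 0 < c) {n k : ℕ} (hn : 2 ≤ n) (hk : 1 ≤ k) :
    (partitionCount c n k : ℝ) + 1 ≤
      (16 * (c + 1) + 4) * ((n : ℝ) ^ ((1 : ℝ) / k) * Real.log n) := by
  have hlog := half_lt_log hn
  have hn1 : (1 : ℝ) ≤ n := by exact_mod_cast (by omega : 1 ≤ n)
  have hpow1 : (1 : ℝ) ≤ (n : ℝ) ^ ((1 : ℝ) / k) := Real.one_le_rpow hn1 (by positivity)
  have hceil : (partitionCount c n k : ℝ) < _ :=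
    Nat.ceil_lt_add_one (a := (c + 1) * (2 * 2 ^ coinsPerTrial n k) * Real.log n) (by positivity)
  have h1 : (c + 1) * (2 * 2 ^ coinsPerTrial n k) * Real.log n ≤
      (c + 1) * (2 * (8 * (n : ℝ) ^ ((1 : ℝ) / k))) * Real.log n := by
    gcongr
    exact two_pow_coinsPerTrial_le hn hk
  -- The ceiling and the extra partition add at most `2`, which the summand `4` of the constant
  -- absorbs.
  have h2 : 1 * (1 / 2) ≤ (n : ℝ) ^ ((1 : ℝ) / k) * Real.log n :=
    mul_le_mul hpow1 hlog.le (by norm_num) (by positivity)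
  linarith

/-- An `O(n ^ (1 / k) log n)`-approximate colouring in `3 k + 3` rounds, with high probability. -/
theorem one_sub_rpow_le_prob_decompositionAlgorithm {c r : ℝ} (hc : 0 < c) {n k : ℕ}
    (hn : 2 ≤ n) (hk : 1 ≤ k)
    (hr : (16 * (c + 1) + 4) * ((n : ℝ) ^ ((1 : ℝ) / k) * Real.log n) ≤ r)
    {V : Type*} (G : SimpleGraph V) (ident : V ≃ Fin n) :
    1 - 1 / (n : ℝ) ^ c ≤
      (decompositionAlgorithm n k (coinsPerTrial n k) (partitionCount c n k)).prob
        {ω | IsApproxColoring G r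
          ((decompositionAlgorithm n k (coinsPerTrial n k) (partitionCount c n k)).coloring
            G ident ω)} := by
  have : Finite V := Finite.of_equiv _ ident.symm
  refine (one_sub_rpow_le hn).trans
    ((decompositionAlgorithm_spec (two_mul_le_two_pow_coinsPerTrial n hk) G ident).trans
      (prob_mono _ fun ω hω => ?_))
  exact IsApproxColoring.mono ((partitionCount_add_one_le hc hn hk).trans hr) hω

/-! ### The trivial colouring by identity numbers -/

theorem isLocal_identity {n : ℕ} :
    IsLocal 0 (fun (_ : NetworkInput n 0) (v : Fin n) => (v : ℕ)) :=
  fun _ _ _ _ => rfl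

/-- Using the identity numbers as colours, without communication. -/
noncomputable def identityAlgorithm (n : ℕ) : RandomizedLocalAlgorithm n :=
  ofLocal 0 fun (_ : NetworkInput n 0) v => v

theorem prob_identityAlgorithm {n : ℕ} (hn : 2 ≤ n) {r : ℝ} (hr : n ≤ r) {V : Type*}
    (G : SimpleGraph V) (ident : V ≃ Fin n) :
    (identityAlgorithm n).prob
      {ω | IsApproxColoring G r ((identityAlgorithm n).coloring G ident ω)} = 1 := by
  have : Finite V := Finite.of_equiv _ ident.symm
  have : Nonempty V := ⟨ident.symm ⟨0, by omega⟩⟩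
  have huniv : {ω | IsApproxColoring G r ((identityAlgorithm n).coloring G ident ω)} =
      Set.univ := by
    refine Set.eq_univ_of_forall fun ω => ?_
    have hcol := ofLocal_coloring (isLocal_identity (n := n)) G ident ω
    refine ⟨fun u v huv => ?_, n, fun v => ?_, hr.trans ?_⟩
    · exact fun h => huv.ne (ident.injective (Fin.ext ((hcol u).symm.trans (h.trans (hcol v)))))
    · exact (hcol v).trans_lt (Fin.is_lt _)
    · have hcolorable : G.Colorable G.chromaticNumber.toNat :=
        G.colorable_chromaticNumber_of_fintype
      have h0 : G.chromaticNumber.toNat ≠ 0 := by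
        intro h
        rw [h, SimpleGraph.colorable_zero_iff] at hcolorable
        exact hcolorable.false (Classical.arbitrary V)
      have h1 : (1 : ℝ) ≤ G.chromaticNumber.toNat := by
        exact_mod_cast Nat.one_le_iff_ne_zero.2 h0
      exact le_mul_of_one_le_right ((Nat.cast_nonneg n).trans hr) h1
  rw [huniv, prob, Nat.card_congr (Equiv.Set.univ _)]
  exact div_self (by exact_mod_cast Nat.card_pos.ne')

end RandomizedLocalAlgorithm

/-! ### The two assertions -/

open RandomizedLocalAlgorithm in
theorem approxColoring_sq_rounds (c : ℝ) (hc : 0 < c) :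
    ∃ C T : ℝ, ∃ A : (n k : ℕ) → RandomizedLocalAlgorithm n,
      ∀ n k : ℕ, 2 ≤ n → 1 ≤ k →
        ((A n k).rounds : ℝ) ≤ T * ((3 : ℝ) ^ k * (k : ℝ) ^ 2) ∧
        ∀ (V : Type*) (G : SimpleGraph V) (ident : V ≃ Fin n),
          1 - 1 / (n : ℝ) ^ c ≤ (A n k).prob
            {ω | IsApproxColoring G (C * ((n : ℝ) ^ ((2 : ℝ) / (k : ℝ)) * Real.log n))
              ((A n k).coloring G ident ω)} := by
  refine ⟨16 * (c + 1) + 4, 6,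
    fun n k => decompositionAlgorithm n k (coinsPerTrial n k) (partitionCount c n k),
    fun n k hn hk => ⟨?_, fun V G ident =>
      one_sub_rpow_le_prob_decompositionAlgorithm hc hn hk ?_ G ident⟩⟩
  · change ((3 * k + 3 : ℕ) : ℝ) ≤ _
    have hk1 : (1 : ℝ) ≤ k := by exact_mod_cast hk
    have h3 : (1 : ℝ) ≤ 3 ^ k := one_le_pow₀ (by norm_num)
    have h2 : (k : ℝ) ≤ k ^ 2 := by nlinarith
    have h4 : 1 * (k : ℝ) ^ 2 ≤ 3 ^ k * (k : ℝ) ^ 2 := by gcongr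
    push_cast
    linarith
  · have hlog := half_lt_log hn
    have hn1 : (1 : ℝ) ≤ n := by exact_mod_cast (by omega : 1 ≤ n)
    have hlog0 : 0 ≤ Real.log n := by linarith
    gcongr
    norm_num

open RandomizedLocalAlgorithm in
theorem approxColoring_rpow (c : ℝ) (hc : 0 < c) :
    ∃ T : ℝ, ∀ ε : ℝ, 0 < ε →
      ∃ C : ℝ, ∃ A : (n : ℕ) → RandomizedLocalAlgorithm n,
        ∀ n : ℕ, 2 ≤ n →
          ((A n).rounds : ℝ) ≤ T * ((3 : ℝ) ^ ⌈1 / ε⌉₊ * (1 / ε ^ 2)) ∧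
          ∀ (V : Type*) (G : SimpleGraph V) (ident : V ≃ Fin n),
            1 - 1 / (n : ℝ) ^ c ≤ (A n).prob
              {ω | IsApproxColoring G (C * (n : ℝ) ^ ε) ((A n).coloring G ident ω)} := by
  refine ⟨18, fun ε hε => ?_⟩
  -- The round bound tends to zero as `ε` grows, so large `ε` calls for an algorithm without
  -- communication; `n` colours suffice there because `n ≤ n ^ ε`.
  rcases le_or_gt 1 ε with h1 | h1
  · refine ⟨1, identityAlgorithm, fun n hn => ⟨?_, fun V G ident => ?_⟩⟩
    · change ((0 : ℕ) : ℝ) ≤ _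
      rw [Nat.cast_zero]
      positivity
    · have hn1 : (1 : ℝ) ≤ n := by exact_mod_cast (by omega : 1 ≤ n)
      rw [prob_identityAlgorithm hn]
      · linarith [show 0 ≤ 1 / (n : ℝ) ^ c by positivity]
      · rw [one_mul]
        exact Real.self_le_rpow_of_one_le hn1 h1
  -- This makes `n ^ (1 / k) ≤ n ^ (ε / 2)`; the other factor `n ^ (ε / 2)` absorbs the logarithm.
  -- The rounds number less than `6 / ε + 6 ≤ 12 / ε ^ 2`, so `18` is ample.
  · set k := ⌈2 / ε⌉₊ with hkdef
    have hk : 1 ≤ k := Nat.one_le_ceil_iff.2 (by positivity)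
    have hk0 : (0 : ℝ) < k := by exact_mod_cast hk
    refine ⟨(16 * (c + 1) + 4) * (1 / (ε / 2)),
      fun n => decompositionAlgorithm n k (coinsPerTrial n k) (partitionCount c n k),
      fun n hn => ⟨?_, fun V G ident =>
        one_sub_rpow_le_prob_decompositionAlgorithm hc hn hk ?_ G ident⟩⟩
    · change ((3 * k + 3 : ℕ) : ℝ) ≤ _
      have hkle : (k : ℝ) < 2 / ε + 1 := Nat.ceil_lt_add_one (by positivity)
      have hε1 : 1 ≤ 1 / ε := one_le_one_div hε h1.le
      have hε2 : 1 / ε ≤ 1 / ε ^ 2 := by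
        rw [← one_div_pow]
        exact le_self_pow₀ hε1 two_ne_zero
      have h3 : 1 * (1 / ε ^ 2) ≤ (3 : ℝ) ^ ⌈1 / ε⌉₊ * (1 / ε ^ 2) := by
        gcongr
        exact one_le_pow₀ (by norm_num)
      have h2 : 2 / ε = 2 * (1 / ε) := by ring
      push_cast
      linarith
    · have hn1 : (1 : ℝ) ≤ n := by exact_mod_cast (by omega : 1 ≤ n)
      have hn0 : (0 : ℝ) < n := by linarith
      have hkε : (1 : ℝ) / k ≤ ε / 2 := by
        rw [div_le_iff₀ hk0]
        have := Nat.le_ceil (2 / ε)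
        rw [div_le_iff₀ hε] at this
        linarith
      have hlog : Real.log n ≤ (n : ℝ) ^ (ε / 2) / (ε / 2) :=
        Real.log_le_rpow_div hn0.le (by positivity)
      have hlog0 : 0 ≤ Real.log n := Real.log_nonneg hn1
      rw [mul_assoc]
      refine mul_le_mul_of_nonneg_left ?_ (by positivity)
      calc (n : ℝ) ^ ((1 : ℝ) / k) * Real.log n
          ≤ (n : ℝ) ^ (ε / 2) * ((n : ℝ) ^ (ε / 2) / (ε / 2)) := by gcongr
        _ = 1 / (ε / 2) * ((n : ℝ) ^ (ε / 2) * (n : ℝ) ^ (ε / 2)) := by ring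
        _ = 1 / (ε / 2) * (n : ℝ) ^ ε := by
          rw [← Real.rpow_add hn0, add_halves]

theorem mainTheorem4 (c : ℝ) (hc : 0 < c) :
    (∃ C T : ℝ, ∃ A : (n k : ℕ) → RandomizedLocalAlgorithm n,
      ∀ n k : ℕ, 2 ≤ n → 1 ≤ k →
        ((A n k).rounds : ℝ) ≤ T * ((3 : ℝ) ^ k * (k : ℝ) ^ 2) ∧
        ∀ (V : Type*) (G : SimpleGraph V) (ident : V ≃ Fin n),
          1 - 1 / (n : ℝ) ^ c ≤ (A n k).prob
            {ω | IsApproxColoring G (C * ((n : ℝ) ^ ((2 : ℝ) / (k : ℝ)) * Real.log n))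
              ((A n k).coloring G ident ω)}) ∧
    (∃ T : ℝ, ∀ ε : ℝ, 0 < ε →
      ∃ C : ℝ, ∃ A : (n : ℕ) → RandomizedLocalAlgorithm n,
        ∀ n : ℕ, 2 ≤ n →
          ((A n).rounds : ℝ) ≤ T * ((3 : ℝ) ^ ⌈1 / ε⌉₊ * (1 / ε ^ 2)) ∧
          ∀ (V : Type*) (G : SimpleGraph V) (ident : V ≃ Fin n),
            1 - 1 / (n : ℝ) ^ c ≤ (A n).prob
              {ω | IsApproxColoring G (C * (n : ℝ) ^ ε) ((A n).coloring G ident ω)}) := by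
  exact ⟨approxColoring_sq_rounds c hc, approxColoring_rpow c hc⟩
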